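/- Let $R$ be a commutative Artinian ring and let $\Lambda$ be an Artinian $R$-algebra, that is, an $R$-algebra which is finitely generated as an $R$-module. Let $$0\to \Lambda\to I^0(\Lambda)\to I^1(\Lambda)\to\cdots$$ be the minimal injective resolution of the left $\Lambda$-module $\Lambda$. Suppose that $\Lambda$ is nonzero and Auslander-regular, i.e. $\Lambda$ is left and right Noetherian, the flat dimension of $I^i(\Lambda)$ is at most $i$ for every $i\ge 0$, and the global dimension of $\Lambda$ is finite. Let $n\geq 0$ be the global dimension of $\Lambda$. Then there exists a simple left $\Lambda$-module $S_2$ of projective dimension $n$ and, if $n\ge 1$, there exists a simple left $\Lambda$-module $S_1$ of projective dimension $n-1$. -/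

import Mathlib

open CategoryTheory TensorProduct MulOpposite

universe u v

/-- The relations `xa ⊗ m = x ⊗ am` imposed on `X ⊗[ℤ] M`, for `X` a right and `M` a left
`Λ`-module. Right `Λ`-modules are modules over `Λᵐᵒᵖ`. -/
def balancedRelations (Λ : Type v) [Ring Λ] (X : Type v) [AddCommGroup X] [Module Λᵐᵒᵖ X]
    (M : Type v) [AddCommGroup M] [Module Λ M] : AddSubgroup (X ⊗[ℤ] M) :=
  AddSubgroup.closure
    {t | ∃ (x : X) (a : Λ) (m : M), t = (op a • x) ⊗ₜ[ℤ] m - x ⊗ₜ[ℤ] (a • m)}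

/-- The tensor product `X ⊗_Λ M` of a right `Λ`-module and a left `Λ`-module over a (not
necessarily commutative) ring `Λ`. -/
abbrev BalancedTensor (Λ : Type v) [Ring Λ] (X : Type v) [AddCommGroup X] [Module Λᵐᵒᵖ X]
    (M : Type v) [AddCommGroup M] [Module Λ M] : Type v :=
  (X ⊗[ℤ] M) ⧸ balancedRelations Λ X M

theorem balancedRelations_le_comap (Λ : Type v) [Ring Λ]
    {X Y : Type v} [AddCommGroup X] [Module Λᵐᵒᵖ X] [AddCommGroup Y] [Module Λᵐᵒᵖ Y]
    (f : X →ₗ[Λᵐᵒᵖ] Y) (M : Type v) [AddCommGroup M] [Module Λ M] :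
    balancedRelations Λ X M ≤ (balancedRelations Λ Y M).comap
      (LinearMap.rTensor M f.toAddMonoidHom.toIntLinearMap).toAddMonoidHom := by
  refine (AddSubgroup.closure_le _).2 ?_
  rintro _ ⟨x, a, m, rfl⟩
  refine AddSubgroup.subset_closure ⟨f x, a, m, ?_⟩
  simp

/-- The map `f ⊗ M : X ⊗_Λ M → Y ⊗_Λ M` induced by a map `f : X → Y` of right modules. -/
def BalancedTensor.map (Λ : Type v) [Ring Λ]
    {X Y : Type v} [AddCommGroup X] [Module Λᵐᵒᵖ X] [AddCommGroup Y] [Module Λᵐᵒᵖ Y]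
    (f : X →ₗ[Λᵐᵒᵖ] Y) (M : Type v) [AddCommGroup M] [Module Λ M] :
    BalancedTensor Λ X M →+ BalancedTensor Λ Y M :=
  QuotientAddGroup.map _ _
    (LinearMap.rTensor M f.toAddMonoidHom.toIntLinearMap).toAddMonoidHom
    (balancedRelations_le_comap Λ f M)

/-- A left `Λ`-module `M` is flat if `- ⊗_Λ M` preserves injections of right `Λ`-modules.
(Mathlib's `Module.Flat` is only available over commutative rings.) -/
def IsFlatModule (Λ : Type v) [Ring Λ] (M : Type v) [AddCommGroup M] [Module Λ M] : Prop :=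
  ∀ (X Y : Type v) [AddCommGroup X] [Module Λᵐᵒᵖ X] [AddCommGroup Y] [Module Λᵐᵒᵖ Y]
    (f : X →ₗ[Λᵐᵒᵖ] Y), Function.Injective f → Function.Injective (BalancedTensor.map Λ f M)

/-- `HasFlatDimensionLE Λ n M` means `fd M ≤ n`: there is an exact sequence
`0 → F_n → ⋯ → F_1 → F_0 → M → 0` with all `F_i` flat. The sequence is built one step at a time:
a surjection `p : F_0 → M` from a flat module whose kernel has such a resolution of length
`n - 1`. -/
def HasFlatDimensionLE (Λ : Type v) [Ring Λ] : ℕ → ModuleCat.{v} Λ → Prop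
  | 0, M => IsFlatModule Λ M
  | n + 1, M => ∃ (F : ModuleCat.{v} Λ) (p : F →ₗ[Λ] M), IsFlatModule Λ F ∧
      Function.Surjective p ∧ HasFlatDimensionLE Λ n (ModuleCat.of Λ (LinearMap.ker p))

/-- A submodule is essential if it meets every nonzero submodule nontrivially. -/
def IsEssentialSubmodule {Λ : Type v} [Ring Λ] {M : Type v} [AddCommGroup M] [Module Λ M]
    (N : Submodule Λ M) : Prop :=
  ∀ L : Submodule Λ M, L ≠ ⊥ → N ⊓ L ≠ ⊥

/-- A minimal injective resolution `0 → M → I⁰ → I¹ → ⋯` of a left `Λ`-module `M`: an exact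
sequence with all `Iⁱ` injective in which `Iⁱ` is an injective envelope of the image of the
preceding map, that is (by exactness), of the kernel of `Iⁱ → Iⁱ⁺¹`. -/
structure MinimalInjectiveResolution (Λ : Type v) [Ring Λ]
    (M : Type v) [AddCommGroup M] [Module Λ M] where
  I : ℕ → ModuleCat.{v} Λ
  ε : M →ₗ[Λ] I 0
  d : ∀ i : ℕ, I i →ₗ[Λ] I (i + 1)
  injective_I : ∀ i, Module.Injective Λ (I i)
  injective_ε : Function.Injective ε
  exact_zero : Function.Exact ε (d 0)
  exact_succ : ∀ i, Function.Exact (d i) (d (i + 1))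
  essential : ∀ i, IsEssentialSubmodule (LinearMap.ker (d i))

/-- A left and right Noetherian ring `Λ` is `n`-Gorenstein if `fd Iⁱ(Λ) ≤ i` for `0 ≤ i ≤ n - 1`,
where `0 → Λ → I⁰(Λ) → I¹(Λ) → ⋯` is the minimal injective resolution of the left module `Λ`
(it exists and is unique up to isomorphism). -/
def IsGorensteinUpTo (Λ : Type v) [Ring Λ] (n : ℕ) : Prop :=
  IsNoetherianRing Λ ∧ IsNoetherianRing Λᵐᵒᵖ ∧
    ∃ J : MinimalInjectiveResolution Λ Λ, ∀ i < n, HasFlatDimensionLE Λ i (J.I i)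

/-- The (left) global dimension of `Λ`: the supremum of the projective dimensions of all left
`Λ`-modules. It is `⊥` exactly for the zero ring. -/
noncomputable def globalDimension (Λ : Type v) [Ring Λ] : WithBot ℕ∞ :=
  ⨆ M : ModuleCat.{v} Λ, projectiveDimension M

/-- `Λ` is Auslander-regular if it is `n`-Gorenstein for all `n` and has finite global
dimension. -/
def IsAuslanderRegular (Λ : Type v) [Ring Λ] : Prop :=
  (∀ n : ℕ, IsGorensteinUpTo Λ n) ∧ globalDimension Λ < ⊤

/-! Write `Zⁱ` for the kernel of `Iⁱ → Iⁱ⁺¹`. For `m ≤ n` the term `Iᵐ` is nonzero: otherwise `Λ`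
would have injective dimension below `n`, whereas over a Noetherian ring of finite global dimension
it equals the global dimension (`hasProjectiveDimensionLT_of_hasInjectiveDimensionLT_self`). As `Λ`
is Artinian, `Iᵐ` contains a simple `S`. Then `pd S ≥ m` (`not_hasProjectiveDimensionLT`): if
`Extᵐ(S, Λ) = 0` with `m ≥ 1`, dimension shifting lifts `S → Zᵐ` to `Iᵐ⁻¹`; the lifted copy of `S`
lies in the essential `Zᵐ⁻¹`, so the differential kills it, which is absurd.

Taking `m = n` gives `S₂`. For `m = n - 1`, flat modules over the semiprimary ring `Λ` are
projective, so `pd Iᵐ ≤ m`; together with `pd (Iᵐ/S) ≤ m + 1` this forces `pd S ≤ m`. -/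

/-! ### Nakayama's lemma for nilpotent ideals, without finiteness of the module -/

section Nakayama

variable {Λ M : Type*} [Ring Λ] [AddCommGroup M] [Module Λ M]

theorem Submodule.eq_bot_of_le_smul_of_isNilpotent {I : Ideal Λ} (hI : IsNilpotent I)
    {N : Submodule Λ M} (h : N ≤ I • N) : N = ⊥ := by
  obtain ⟨k, hk⟩ := hI
  have key : ∀ j : ℕ, N ≤ I ^ j • N := by
    intro j
    induction j with
    | zero => simp [Submodule.pow_zero, Ideal.one_eq_top]
    | succ j ih =>
      rw [Submodule.pow_succ, Submodule.mul_smul]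
      exact ih.trans (Submodule.smul_mono le_rfl h)
  simpa [hk] using key k

theorem Submodule.eq_top_of_sup_smul_top_of_isNilpotent {I : Ideal Λ} (hI : IsNilpotent I)
    {N : Submodule Λ M} (h : N ⊔ I • ⊤ = ⊤) : N = ⊤ := by
  obtain ⟨k, hk⟩ := hI
  have key : ∀ j : ℕ, N ⊔ I ^ j • ⊤ = ⊤ := by
    intro j
    induction j with
    | zero => simp [Submodule.pow_zero, Ideal.one_eq_top]
    | succ j ih =>
      refine top_le_iff.1 (ih.ge.trans (sup_le le_sup_left ?_))
      conv_lhs => rw [← h]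
      rw [Submodule.smul_sup, Submodule.pow_succ, Submodule.mul_smul]
      exact sup_le_sup_right Submodule.smul_le_right _
  simpa [hk] using key k

end Nakayama

/-! ### Endomorphisms modulo a nilpotent ideal -/

section LiftIdempotents

variable {Λ F : Type*} [Ring Λ] [AddCommGroup F] [Module Λ F] (I : Ideal Λ)

/-- Reduction of endomorphisms of `F` modulo `IF`. -/
def Module.End.reduce : Module.End Λ F →+* Module.End Λ (F ⧸ (I • ⊤ : Submodule Λ F)) where
  toFun f := Submodule.mapQ _ _ f (Submodule.smul_top_le_comap_smul_top I f)
  map_one' := by ext; rfl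
  map_mul' _ _ := by ext; rfl
  map_zero' := by ext; rfl
  map_add' _ _ := by ext; rfl

theorem Module.End.reduce_mk (f : Module.End Λ F) (x : F) :
    Module.End.reduce I f (Submodule.Quotient.mk x) = Submodule.Quotient.mk (f x) := rfl

/-- Such an `f` maps `F` into `IF`, hence `f ^ j` maps `F` into `I ^ j F`. This nilpotence is what
lets idempotents lift. -/
theorem Module.End.isNilpotent_of_mem_ker_reduce {I : Ideal Λ} (hI : IsNilpotent I)
    {f : Module.End Λ F} (hf : f ∈ RingHom.ker (Module.End.reduce (F := F) I)) :
    IsNilpotent f := by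
  obtain ⟨k, hk⟩ := hI
  have hr : LinearMap.range f ≤ I • ⊤ := by
    rintro _ ⟨x, rfl⟩
    rw [← Submodule.Quotient.mk_eq_zero, ← Module.End.reduce_mk, (RingHom.mem_ker).1 hf]
    rfl
  have key : ∀ j : ℕ, LinearMap.range (f ^ j) ≤ I ^ j • ⊤ := by
    intro j
    induction j with
    | zero => simp [Submodule.pow_zero, Ideal.one_eq_top]
    | succ j ih =>
      rw [pow_succ' f, Module.End.mul_eq_comp, LinearMap.range_comp]
      refine (Submodule.map_mono ih).trans ?_
      rw [Submodule.map_smul'', Submodule.map_top, Submodule.pow_succ, Submodule.mul_smul]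
      exact Submodule.smul_mono le_rfl hr
  refine ⟨k, LinearMap.range_eq_bot.1 (le_bot_iff.1 ?_)⟩
  simpa [hk] using key k

end LiftIdempotents

/-! ### Projective covers over a semiprimary ring -/

section ProjectiveCover

variable {Λ : Type*} [Ring Λ] [IsSemiprimaryRing Λ]

theorem IsSemiprimaryRing.isSemisimpleModule_quotient_smul_top (M : Type*) [AddCommGroup M]
    [Module Λ M] : IsSemisimpleModule Λ (M ⧸ (Ring.jacobson Λ • ⊤ : Submodule Λ M)) := by
  have h : Module.IsTorsionBySet Λ (M ⧸ (Ring.jacobson Λ • ⊤ : Submodule Λ M))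
      (Ring.jacobson Λ) := by
    rw [Module.isTorsionBySet_quotient_iff]
    exact fun m i hi ↦ Submodule.smul_mem_smul hi trivial
  let _ := h.module
  exact (h.semilinearMap.isSemisimpleModule_iff_of_bijective Function.bijective_id).2
    inferInstance

/-- Every module over a semiprimary ring has a projective cover. -/
theorem IsSemiprimaryRing.exists_projective_surjective_ker_le (F : Type u) (M : Type*)
    [AddCommGroup F] [Module Λ F] [Module.Projective Λ F] [AddCommGroup M] [Module Λ M]
    (π : F →ₗ[Λ] M) (hπ : Function.Surjective π) :
    ∃ (P : Type u) (_ : AddCommGroup P) (_ : Module Λ P) (p : P →ₗ[Λ] M), Module.Projective Λ P ∧ Function.Surjective p ∧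
      LinearMap.ker p ≤ Ring.jacobson Λ • ⊤ := by
  set J := Ring.jacobson Λ
  have hJ : IsNilpotent J := IsSemiprimaryRing.isNilpotent
  have := IsSemiprimaryRing.isSemisimpleModule_quotient_smul_top (Λ := Λ) F
  have := IsSemiprimaryRing.isSemisimpleModule_quotient_smul_top (Λ := Λ) M
  let πq : (F ⧸ (J • ⊤ : Submodule Λ F)) →ₗ[Λ] (M ⧸ (J • ⊤ : Submodule Λ M)) :=
    Submodule.mapQ _ _ π (Submodule.smul_top_le_comap_smul_top J π)
  have hπq : ∀ x : F, πq (Submodule.Quotient.mk x) = Submodule.Quotient.mk (π x) := fun _ ↦ rfl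
  have hsurj : Function.Surjective πq := by
    intro y
    obtain ⟨m, rfl⟩ := Submodule.Quotient.mk_surjective _ y
    obtain ⟨x, rfl⟩ := hπ m
    exact ⟨_, hπq x⟩
  obtain ⟨s, hs⟩ := IsSemisimpleModule.lifting_property πq hsurj LinearMap.id
  have hs' : ∀ y, πq (s y) = y := fun y ↦ LinearMap.congr_fun hs y
  have hred : Function.Surjective (Module.End.reduce (F := F) J) := by
    intro g
    obtain ⟨f, hf⟩ := Module.projective_lifting_property (Submodule.mkQ (J • ⊤ : Submodule Λ F))
      (g ∘ₗ Submodule.mkQ _) (Submodule.mkQ_surjective _)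
    refine ⟨f, ?_⟩
    ext x
    exact LinearMap.congr_fun hf x
  -- The section `s` realizes `M/JM` as a summand of `F/JF`. Its idempotent `s ∘ πq` lifts to an
  -- idempotent `e` of `F`, and the cover is the summand `eF`.
  obtain ⟨e, he, hes⟩ := exists_isIdempotentElem_eq_of_ker_isNilpotent
    (Module.End.reduce (F := F) J)
    (fun x hx ↦ Module.End.isNilpotent_of_mem_ker_reduce hJ hx) (s ∘ₗ πq : Module.End Λ _)
    (hred _) (by ext x; exact congrArg s (hs' _))
  have hee : ∀ x, e (e x) = e x := fun x ↦ LinearMap.congr_fun he x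
  have hes' : ∀ x : F, (Submodule.Quotient.mk (e x) : F ⧸ (J • ⊤ : Submodule Λ F)) =
      s (πq (Submodule.Quotient.mk x)) := fun x ↦ by
    rw [← Module.End.reduce_mk, hes]; rfl
  refine ⟨LinearMap.range e, inferInstance, inferInstance, π ∘ₗ (LinearMap.range e).subtype, ?_, ?_, ?_⟩
  · refine Module.Projective.of_split (LinearMap.range e).subtype e.rangeRestrict ?_
    ext ⟨_, x, rfl⟩
    exact hee x
  · rw [← LinearMap.range_eq_top]
    refine Submodule.eq_top_of_sup_smul_top_of_isNilpotent hJ (top_le_iff.1 ?_)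
    intro m _
    obtain ⟨x, rfl⟩ := hπ m
    have h1 : π x - π (e x) ∈ (J • ⊤ : Submodule Λ M) := by
      rw [← Submodule.Quotient.eq, ← hπq, ← hπq, hes', hs']
    rw [← add_sub_cancel (π (e x)) (π x)]
    exact Submodule.add_mem_sup ⟨⟨e x, x, rfl⟩, rfl⟩ h1
  · rintro ⟨_, x, rfl⟩ hx
    have hx' : π (e x) = 0 := hx
    have h1 : e x ∈ (J • ⊤ : Submodule Λ F) := by
      rw [← Submodule.Quotient.mk_eq_zero, ← hee, hes', hπq, hx', Submodule.Quotient.mk_zero,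
        map_zero]
    -- Membership in `JF` passes to `J(eF)` by applying the retraction `F → eF`.
    have h2 : e.rangeRestrict (e x) ∈ (J • ⊤ : Submodule Λ (LinearMap.range e)) :=
      Submodule.smul_top_le_comap_smul_top J e.rangeRestrict h1
    convert h2 using 1
    exact Subtype.ext (hee x).symm

end ProjectiveCover

/-! ### Flat modules over a semiprimary ring are projective -/

section Flat

variable {Λ : Type v} [Ring Λ]

/-- A two-sided ideal as a right submodule. -/
def Ideal.toRight (I : Ideal Λ) [I.IsTwoSided] : Submodule Λᵐᵒᵖ Λ where
  carrier := I
  add_mem' := I.add_mem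
  zero_mem' := I.zero_mem
  smul_mem' a _ hx := I.mul_mem_right a.unop hx

/-- Half of `Λ ⊗_Λ M ≅ M`: a tensor that multiplies to zero is a balanced relation. -/
theorem BalancedTensor.mk_eq_mk_one_tmul {M : Type v} [AddCommGroup M] [Module Λ M]
    (t : Λ ⊗[ℤ] M) :
    ∃ m : M, t - 1 ⊗ₜ m ∈ balancedRelations Λ Λ M ∧
      m = TensorProduct.lift (LinearMap.mk₂ ℤ (fun (a : Λ) (m : M) ↦ a • m) add_smul
        (fun c a m ↦ smul_assoc c a m) smul_add (fun c a m ↦ smul_comm a c m)) t := by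
  induction t with
  | zero => exact ⟨0, by simp⟩
  | tmul a m => exact ⟨a • m, AddSubgroup.subset_closure ⟨1, a, m, by simp⟩, by simp⟩
  | add x y hx hy =>
    obtain ⟨m, hm, hm'⟩ := hx
    obtain ⟨n, hn, hn'⟩ := hy
    refine ⟨m + n, ?_, by rw [map_add, hm', hn']⟩
    have := add_mem hm hn
    rw [TensorProduct.tmul_add]
    convert this using 1
    abel

/-- The multiplication `I ⊗ M → M` for a two-sided ideal `I`. -/
noncomputable def Ideal.tensorAct (I : Ideal Λ) [I.IsTwoSided] (M : Type v) [AddCommGroup M]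
    [Module Λ M] : I.toRight ⊗[ℤ] M →ₗ[ℤ] M :=
  TensorProduct.lift (LinearMap.mk₂ ℤ (fun (a : I.toRight) (m : M) ↦ (a : Λ) • m)
    (fun _ _ _ ↦ add_smul _ _ _) (fun c a m ↦ smul_assoc c (a : Λ) m) (fun _ _ _ ↦ smul_add _ _ _)
    (fun c a m ↦ smul_comm (a : Λ) c m))

@[simp]
theorem Ideal.tensorAct_tmul (I : Ideal Λ) [I.IsTwoSided] {M : Type v} [AddCommGroup M]
    [Module Λ M] (a : I.toRight) (m : M) : I.tensorAct M (a ⊗ₜ m) = (a : Λ) • m := rfl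

theorem Ideal.tensorAct_lTensor (I : Ideal Λ) [I.IsTwoSided] {M N : Type v} [AddCommGroup M]
    [Module Λ M] [AddCommGroup N] [Module Λ N] (p : M →ₗ[Λ] N) (t : I.toRight ⊗[ℤ] M) :
    I.tensorAct N (LinearMap.lTensor _ p.toAddMonoidHom.toIntLinearMap t) =
      p (I.tensorAct M t) := by
  induction t with
  | zero => simp
  | tmul a m => simp
  | add x y hx hy => simp only [map_add, hx, hy]

theorem Ideal.tensorAct_mem (I : Ideal Λ) [I.IsTwoSided] {M : Type v} [AddCommGroup M]
    [Module Λ M] (t : I.toRight ⊗[ℤ] M) : I.tensorAct M t ∈ (I • ⊤ : Submodule Λ M) := by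
  induction t with
  | zero => simp
  | tmul a m => exact Submodule.smul_mem_smul a.2 trivial
  | add x y hx hy => rw [map_add]; exact add_mem hx hy

theorem Ideal.exists_tensorAct_eq (I : Ideal Λ) [I.IsTwoSided] {M : Type v} [AddCommGroup M]
    [Module Λ M] {x : M} (hx : x ∈ (I • ⊤ : Submodule Λ M)) :
    ∃ t : I.toRight ⊗[ℤ] M, I.tensorAct M t = x := by
  induction hx using Submodule.smul_induction_on' with
  | smul a ha m _ => exact ⟨(⟨a, ha⟩ : I.toRight) ⊗ₜ m, rfl⟩
  | add x _ y _ hx hy =>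
    obtain ⟨s, rfl⟩ := hx
    obtain ⟨t, rfl⟩ := hy
    exact ⟨s + t, map_add _ _ _⟩

theorem Ideal.tensorAct_eq_zero_of_mem_balancedRelations (I : Ideal Λ) [I.IsTwoSided] {M : Type v}
    [AddCommGroup M] [Module Λ M] {t : I.toRight ⊗[ℤ] M}
    (ht : t ∈ balancedRelations Λ I.toRight M) : I.tensorAct M t = 0 := by
  induction ht using AddSubgroup.closure_induction with
  | mem _ h =>
    obtain ⟨a, b, m, rfl⟩ := h
    rw [map_sub, Ideal.tensorAct_tmul, Ideal.tensorAct_tmul, smul_smul, sub_eq_zero]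
    rfl
  | zero => simp
  | add x y _ _ hx hy => rw [map_add, hx, hy, add_zero]
  | neg x _ hx => rw [map_neg, hx, neg_zero]

theorem balancedRelations_lift {X M N : Type v} [AddCommGroup X] [Module Λᵐᵒᵖ X]
    [AddCommGroup M] [Module Λ M] [AddCommGroup N] [Module Λ N] {p : M →ₗ[Λ] N}
    (hp : Function.Surjective p) {t : X ⊗[ℤ] N} (ht : t ∈ balancedRelations Λ X N) :
    ∃ s ∈ balancedRelations Λ X M,
      LinearMap.lTensor X p.toAddMonoidHom.toIntLinearMap s = t := by
  induction ht using AddSubgroup.closure_induction with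
  | mem _ h =>
    obtain ⟨a, b, n, rfl⟩ := h
    obtain ⟨m, rfl⟩ := hp n
    exact ⟨_, AddSubgroup.subset_closure ⟨a, b, m, rfl⟩, by simp⟩
  | zero => exact ⟨0, zero_mem _, map_zero _⟩
  | add x y _ _ hx hy =>
    obtain ⟨s, hs, rfl⟩ := hx
    obtain ⟨t, ht, rfl⟩ := hy
    exact ⟨s + t, add_mem hs ht, map_add _ _ _⟩
  | neg x _ hx =>
    obtain ⟨s, hs, rfl⟩ := hx
    exact ⟨-s, neg_mem hs, map_neg _ _⟩

/-- Flatness applied to `I ↪ Λ` makes `I ⊗_Λ M → Λ ⊗_Λ M ≅ M` injective. -/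
theorem IsFlatModule.mem_balancedRelations {M : Type v} [AddCommGroup M] [Module Λ M]
    (hM : IsFlatModule Λ M) (I : Ideal Λ) [I.IsTwoSided] {t : I.toRight ⊗[ℤ] M}
    (ht : I.tensorAct M t = 0) : t ∈ balancedRelations Λ I.toRight M := by
  rw [← QuotientAddGroup.eq_zero_iff]
  refine hM _ _ I.toRight.subtype Subtype.val_injective ?_
  rw [map_zero]
  obtain ⟨m, hm, hm'⟩ := BalancedTensor.mk_eq_mk_one_tmul
    (LinearMap.rTensor M I.toRight.subtype.toAddMonoidHom.toIntLinearMap t)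
  have : m = 0 := by
    rw [hm', ← ht]
    clear hm hm' ht
    induction t with
    | zero => simp
    | tmul a m => simp
    | add x y hx hy => simp only [map_add, hx, hy]
  rw [this, TensorProduct.tmul_zero, sub_zero] at hm
  exact (QuotientAddGroup.eq_zero_iff _).2 hm

/-- If `P → M` is surjective with `M` flat and kernel `K`, then `K ∩ IP = IK`. -/
theorem IsFlatModule.ker_le_smul_ker {P M : Type v} [AddCommGroup P] [Module Λ P]
    [AddCommGroup M] [Module Λ M] (hM : IsFlatModule Λ M) {p : P →ₗ[Λ] M}
    (hp : Function.Surjective p) (I : Ideal Λ) [I.IsTwoSided]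
    (hI : LinearMap.ker p ≤ I • ⊤) : LinearMap.ker p ≤ I • LinearMap.ker p := by
  intro x hx
  obtain ⟨t, rfl⟩ := I.exists_tensorAct_eq (hI hx)
  -- Since `p x = 0`, the image of `t` in `I ⊗ M` is a relation, so it lifts to a relation `s` in `I
  -- ⊗ P`. Then `t - s` still multiplies to `x`, but comes from `I ⊗ ker p`.
  obtain ⟨s, hs, hst⟩ := balancedRelations_lift hp (hM.mem_balancedRelations I
    (t := LinearMap.lTensor _ p.toAddMonoidHom.toIntLinearMap t)
    ((I.tensorAct_lTensor p t).trans hx))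
  have hex : Function.Exact (LinearMap.ker p).subtype.toAddMonoidHom.toIntLinearMap
      p.toAddMonoidHom.toIntLinearMap := fun y ↦
    ⟨fun hy ↦ ⟨⟨y, hy⟩, rfl⟩, by rintro ⟨⟨y, hy⟩, rfl⟩; exact hy⟩
  obtain ⟨w, hw⟩ := (lTensor_exact I.toRight hex hp (t - s)).1 (by
    rw [map_sub, hst, sub_self])
  have h1 := I.tensorAct_lTensor (LinearMap.ker p).subtype w
  rw [hw, map_sub, I.tensorAct_eq_zero_of_mem_balancedRelations hs, sub_zero] at h1
  rw [h1]
  have h2 := Submodule.mem_map_of_mem (f := (LinearMap.ker p).subtype) (I.tensorAct_mem w)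
  rwa [Submodule.map_smul'', Submodule.map_top, Submodule.range_subtype] at h2

/-- A flat quotient of a projective module by a superfluous submodule is projective. -/
theorem IsFlatModule.projective_of_ker_le {P M : Type v} [AddCommGroup P] [Module Λ P]
    [Module.Projective Λ P] [AddCommGroup M] [Module Λ M] (hM : IsFlatModule Λ M)
    {p : P →ₗ[Λ] M} (hp : Function.Surjective p) {I : Ideal Λ} [I.IsTwoSided] (hI : IsNilpotent I)
    (hker : LinearMap.ker p ≤ I • ⊤) : Module.Projective Λ M := by
  have hbot : LinearMap.ker p = ⊥ :=
    Submodule.eq_bot_of_le_smul_of_isNilpotent hI (hM.ker_le_smul_ker hp I hker)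
  exact Module.Projective.of_equiv
    (LinearEquiv.ofBijective p ⟨LinearMap.ker_eq_bot.1 hbot, hp⟩)

/-- Flat modules over a semiprimary ring are projective. -/
theorem IsFlatModule.projective [IsSemiprimaryRing Λ] {M : Type v} [AddCommGroup M] [Module Λ M]
    (hM : IsFlatModule Λ M) : Module.Projective Λ M := by
  obtain ⟨P, _, _, p, hP, hp, hker⟩ := IsSemiprimaryRing.exists_projective_surjective_ker_le
    (Λ := Λ) (M →₀ Λ) M (Finsupp.linearCombination Λ id)
    (Finsupp.linearCombination_id_surjective Λ M)
  exact hM.projective_of_ker_le hp IsSemiprimaryRing.isNilpotent hker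

theorem ModuleCat.shortExact_ker {F M : ModuleCat.{v} Λ} (p : F →ₗ[Λ] M)
    (hp : Function.Surjective p) :
    (ModuleCat.shortComplexOfCompEqZero (R := Λ) (LinearMap.ker p).subtype p
      (LinearMap.comp_ker_subtype p)).ShortExact :=
  ModuleCat.shortComplex_shortExact _ (LinearMap.exact_subtype_ker_map p)
    Subtype.val_injective hp

theorem HasFlatDimensionLE.hasProjectiveDimensionLE [IsSemiprimaryRing Λ] {n : ℕ}
    {M : ModuleCat.{v} Λ} (h : HasFlatDimensionLE Λ n M) : HasProjectiveDimensionLE M n := by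
  induction n generalizing M with
  | zero =>
    have := IsFlatModule.projective h
    exact (projective_iff_hasProjectiveDimensionLE_zero M).1 ((IsProjective.iff_projective (R := Λ) M).1 this)
  | succ n ih =>
    obtain ⟨F, p, hF, hp, hK⟩ := h
    have := (IsProjective.iff_projective (R := Λ) F).1 hF.projective
    exact (ModuleCat.shortExact_ker p hp).hasProjectiveDimensionLT_X₃ (n + 1) (ih hK)
      (inferInstanceAs (HasProjectiveDimensionLT F (n + 1 + 1)))

end Flat

/-! ### Global dimension and the injective dimension of the ring -/

section Dimension

variable {Λ : Type v} [Ring Λ]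

theorem ModuleCat.injective_of_module {M : ModuleCat.{v} Λ} (h : Module.Injective Λ M) :
    Injective M :=
  Module.injective_object_of_injective_module Λ M

theorem ModuleCat.shortExact_quotient {M : Type v} [AddCommGroup M] [Module Λ M]
    (N : Submodule Λ M) :
    (ModuleCat.shortComplexOfCompEqZero (R := Λ) N.subtype N.mkQ
      (by ext; simp)).ShortExact :=
  ModuleCat.shortComplex_shortExact _ (LinearMap.exact_subtype_mkQ N)
    Subtype.val_injective N.mkQ_surjective

theorem hasInjectiveDimensionLT_pi {n : ℕ} (h : HasInjectiveDimensionLT (ModuleCat.of Λ Λ) n)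
    (k : ℕ) : HasInjectiveDimensionLT (ModuleCat.of Λ (Fin k → Λ)) n := by
  induction k with
  | zero =>
    have := (ModuleCat.isZero_of_subsingleton
      (ModuleCat.of Λ (Fin 0 → Λ))).hasInjectiveDimensionLT_zero
    exact hasInjectiveDimensionLT_of_ge _ 0 n (Nat.zero_le n)
  | succ k ih =>
    have hex : Function.Exact (LinearMap.single Λ (fun _ : Fin (k + 1) ↦ Λ) 0)
        (LinearMap.funLeft Λ Λ (Fin.succ : Fin k → Fin (k + 1))) := by
      intro x
      constructor
      · intro hx
        refine ⟨x 0, funext fun i ↦ ?_⟩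
        refine Fin.cases (by simp) (fun i ↦ ?_) i
        have := congrFun hx i
        simpa using this.symm
      · rintro ⟨a, rfl⟩
        ext i
        simp [LinearMap.funLeft_apply]
    have hS := ModuleCat.shortComplex_shortExact
      (ModuleCat.shortComplexOfCompEqZero (R := Λ) _ _ hex.linearMap_comp_eq_zero) hex
      (Pi.single_injective (M := fun _ : Fin (k + 1) ↦ Λ) 0)
      (LinearMap.funLeft_surjective_of_injective Λ Λ _ (Fin.succ_injective k))
    exact hS.hasInjectiveDimensionLT_X₂ n h ih

/-- If every module has injective dimension at most `n` and `Λ` has injective dimension less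
than `n`, then so does every finitely generated module. -/
theorem hasInjectiveDimensionLT_of_finite {n : ℕ}
    (hgl : ∀ N : ModuleCat.{v} Λ, HasInjectiveDimensionLT N (n + 1))
    (h : HasInjectiveDimensionLT (ModuleCat.of Λ Λ) n) (N : ModuleCat.{v} Λ)
    [Module.Finite Λ N] : HasInjectiveDimensionLT N n := by
  obtain ⟨k, f, hf⟩ := Module.Finite.exists_fin' Λ N
  exact (ModuleCat.shortExact_ker (F := ModuleCat.of Λ (Fin k → Λ)) f
    hf).hasInjectiveDimensionLT_X₃ n (hasInjectiveDimensionLT_pi h k) (hgl _)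

/-- Over a Noetherian ring the projective dimension of a finitely generated module is detected
by finitely generated modules. -/
theorem hasProjectiveDimensionLT_of_finite [IsNoetherianRing Λ] (n : ℕ) (M : ModuleCat.{v} Λ)
    [Module.Finite Λ M]
    (h : ∀ (N : ModuleCat.{v} Λ) [Module.Finite Λ N], Subsingleton (Abelian.Ext M N (n + 1))) :
    HasProjectiveDimensionLT M (n + 1) := by
  obtain ⟨k, f, hf⟩ := Module.Finite.exists_fin' Λ M
  have hS := ModuleCat.shortExact_ker (F := ModuleCat.of Λ (Fin k → Λ)) f hf
  have hproj : Projective (ModuleCat.of Λ (Fin k → Λ)) :=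
    (IsProjective.iff_projective (R := Λ) (Fin k → Λ)).1 inferInstance
  induction n generalizing M k with
  | zero =>
    have hK : Module.Finite Λ (ModuleCat.of Λ (LinearMap.ker f)) :=
      inferInstanceAs (Module.Finite Λ (LinearMap.ker f))
    -- Vanishing of `Ext¹(M, ker f)` lifts the identity of `M`, so `M` is a retract of a free
    -- module.
    obtain ⟨x, hx⟩ := Abelian.Ext.covariant_sequence_exact₃ M hS (Abelian.Ext.mk₀ (𝟙 M)) (zero_add 1)
      (by have := h (ModuleCat.of Λ (LinearMap.ker f)); exact Subsingleton.elim _ _)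
    obtain ⟨s, rfl⟩ := Abelian.Ext.homEquiv₀.symm.surjective x
    have hs : s ≫ ModuleCat.ofHom f = 𝟙 M :=
      Abelian.Ext.homEquiv₀.symm.injective (by simpa using hx)
    have : HasProjectiveDimensionLT (ModuleCat.of Λ (Fin k → Λ)) 1 := inferInstance
    exact Retract.hasProjectiveDimensionLT ⟨s, ModuleCat.ofHom f, hs⟩ 1
  | succ n ih =>
    have hK : Module.Finite Λ (ModuleCat.of Λ (LinearMap.ker f)) :=
      inferInstanceAs (Module.Finite Λ (LinearMap.ker f))
    refine (hS.hasProjectiveDimensionLT_X₃_iff n hproj).2 ?_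
    obtain ⟨l, g, hg⟩ := Module.Finite.exists_fin' Λ (ModuleCat.of Λ (LinearMap.ker f))
    refine ih (ModuleCat.of Λ (LinearMap.ker f)) (fun N _ ↦ ⟨fun a b ↦ ?_⟩) l g hg
      (ModuleCat.shortExact_ker (F := ModuleCat.of Λ (Fin l → Λ)) g hg)
      ((IsProjective.iff_projective (R := Λ) (Fin l → Λ)).1 inferInstance)
    suffices ∀ a : Abelian.Ext (ModuleCat.of Λ (LinearMap.ker f)) N (n + 1), a = 0 by
      rw [this a, this b]
    intro a
    obtain ⟨y, rfl⟩ := Abelian.Ext.contravariant_sequence_exact₁ hS N a (add_comm 1 (n + 1))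
      (by have := h N; exact Subsingleton.elim _ _)
    have hy : y = 0 := Abelian.Ext.eq_zero_of_projective _
    rw [hy, Abelian.Ext.comp_zero]

/-- Baer's criterion for the injective dimension. -/
theorem hasInjectiveDimensionLT_of_ideal (n : ℕ) (N : ModuleCat.{v} Λ)
    (h : ∀ I : Ideal Λ, Subsingleton (Abelian.Ext (ModuleCat.of Λ (Λ ⧸ I)) N (n + 1))) :
    HasInjectiveDimensionLT N (n + 1) := by
  induction n generalizing N with
  | zero =>
    suffices Module.Injective Λ N by
      have := ModuleCat.injective_of_module this
      infer_instance
    refine Module.Baer.injective fun I g ↦ ?_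
    obtain ⟨x, hx⟩ := Abelian.Ext.contravariant_sequence_exact₁ (ModuleCat.shortExact_quotient I)
      N (Abelian.Ext.mk₀ (ModuleCat.ofHom g)) (add_zero 1)
      (by have := h I; exact Subsingleton.elim _ _)
    obtain ⟨s, rfl⟩ := Abelian.Ext.homEquiv₀.symm.surjective x
    have hs : ModuleCat.ofHom I.subtype ≫ s = ModuleCat.ofHom g :=
      Abelian.Ext.homEquiv₀.symm.injective (by simpa using hx)
    exact ⟨s.hom, fun x hx ↦ LinearMap.congr_fun (congrArg ModuleCat.Hom.hom hs) ⟨x, hx⟩⟩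
  | succ n ih =>
    obtain ⟨p⟩ := EnoughInjectives.presentation N
    have hS : (ShortComplex.mk _ _ (Limits.cokernel.condition p.f)).ShortExact :=
      { exact := ShortComplex.exact_cokernel p.f }
    refine (hS.hasInjectiveDimensionLT_X₃_iff n p.injective).1 (ih _ fun I ↦ ⟨fun a b ↦ ?_⟩)
    suffices ∀ a : Abelian.Ext (ModuleCat.of Λ (Λ ⧸ I)) (Limits.cokernel p.f) (n + 1), a = 0 by
      rw [this a, this b]
    intro a
    obtain ⟨y, rfl⟩ := Abelian.Ext.covariant_sequence_exact₃ _ hS a rfl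
      (by have := h I; exact Subsingleton.elim _ _)
    have := p.injective
    have hy : y = 0 := Abelian.Ext.eq_zero_of_injective _
    rw [hy, Abelian.Ext.zero_comp]

/-- Over a left Noetherian ring of finite global dimension, the global dimension is the injective
dimension of the ring. -/
theorem hasProjectiveDimensionLT_of_hasInjectiveDimensionLT_self [IsNoetherianRing Λ] {n : ℕ}
    (hgl : ∀ M : ModuleCat.{v} Λ, HasProjectiveDimensionLT M (n + 2))
    (h : HasInjectiveDimensionLT (ModuleCat.of Λ Λ) (n + 1)) (M : ModuleCat.{v} Λ) :
    HasProjectiveDimensionLT M (n + 1) := by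
  have hinj (N : ModuleCat.{v} Λ) : HasInjectiveDimensionLT N (n + 1 + 1) :=
    HasInjectiveDimensionLT.mk fun i hi Y e ↦ by
      have := hgl Y
      exact e.eq_zero_of_hasProjectiveDimensionLT (n + 2) hi
  -- Finitely generated modules have injective dimension at most `n`, which bounds `pd (Λ ⧸ I)`.
  -- Baer's criterion then carries the bound to arbitrary modules `N`.
  have hpd (I : Ideal Λ) : HasProjectiveDimensionLT (ModuleCat.of Λ (Λ ⧸ I)) (n + 1) := by
    have : Module.Finite Λ (ModuleCat.of Λ (Λ ⧸ I)) := inferInstanceAs (Module.Finite Λ (Λ ⧸ I))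
    refine hasProjectiveDimensionLT_of_finite n _ fun N _ ↦ ?_
    have := hasInjectiveDimensionLT_of_finite hinj h N
    exact HasInjectiveDimensionLT.subsingleton N (n + 1) (n + 1) le_rfl _
  refine HasProjectiveDimensionLT.mk fun i hi N e ↦ ?_
  have : HasInjectiveDimensionLT N (n + 1) := by
    refine hasInjectiveDimensionLT_of_ideal n N fun I ↦ ?_
    have := hpd I
    exact HasProjectiveDimensionLT.subsingleton _ (n + 1) (n + 1) le_rfl _
  exact e.eq_zero_of_hasInjectiveDimensionLT (n + 1) hi

end Dimension

/-! ### Simple submodules of the minimal injective resolution -/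

namespace MinimalInjectiveResolution

variable {Λ : Type v} [Ring Λ] {M : Type v} [AddCommGroup M] [Module Λ M]
  (J : MinimalInjectiveResolution Λ M)

/-- The cosyzygies `ker (Iⁱ → Iⁱ⁺¹)`. -/
abbrev cosyzygy (i : ℕ) : ModuleCat.{v} Λ := ModuleCat.of Λ (LinearMap.ker (J.d i))

/-- The differential with its image as codomain. -/
def toCosyzygy (i : ℕ) : J.I i →ₗ[Λ] LinearMap.ker (J.d (i + 1)) :=
  (J.d i).codRestrict _ fun x ↦ (J.exact_succ i _).2 ⟨x, rfl⟩

theorem exact_toCosyzygy (i : ℕ) :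
    Function.Exact (LinearMap.ker (J.d i)).subtype (J.toCosyzygy i) := fun x ↦
  ⟨fun h ↦ ⟨⟨x, congrArg Subtype.val h⟩, rfl⟩, by rintro ⟨⟨y, hy⟩, rfl⟩; exact Subtype.ext hy⟩

theorem toCosyzygy_surjective (i : ℕ) : Function.Surjective (J.toCosyzygy i) := by
  rintro ⟨y, hy⟩
  obtain ⟨x, rfl⟩ := (J.exact_succ i y).1 hy
  exact ⟨x, rfl⟩

theorem shortExact (i : ℕ) :
    (ModuleCat.shortComplexOfCompEqZero (R := Λ) (LinearMap.ker (J.d i)).subtype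
      (J.toCosyzygy i) (J.exact_toCosyzygy i).linearMap_comp_eq_zero).ShortExact :=
  ModuleCat.shortComplex_shortExact _ (J.exact_toCosyzygy i) Subtype.val_injective
    (J.toCosyzygy_surjective i)

theorem subsingleton_ext_cosyzygy (X : ModuleCat.{v} Λ) (i j : ℕ)
    (h : Subsingleton (Abelian.Ext X (J.cosyzygy 0) (i + j + 1))) :
    Subsingleton (Abelian.Ext X (J.cosyzygy i) (j + 1)) := by
  induction i generalizing j with
  | zero => rwa [zero_add] at h
  | succ i ih =>
    have := ih (j + 1) (by rwa [show i + (j + 1) + 1 = i + 1 + j + 1 by lia])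
    have := ModuleCat.injective_of_module (J.injective_I i)
    suffices ∀ a : Abelian.Ext X (J.cosyzygy (i + 1)) (j + 1), a = 0 from
      ⟨fun a b ↦ by rw [this a, this b]⟩
    intro a
    obtain ⟨y, rfl⟩ := Abelian.Ext.covariant_sequence_exact₃ X (J.shortExact i) a rfl
      (Subsingleton.elim _ _)
    have hy : y = 0 := Abelian.Ext.eq_zero_of_injective _
    rw [hy, Abelian.Ext.zero_comp]

theorem simple_le_of_essential {N S : Submodule Λ M} (hN : IsEssentialSubmodule N)
    (hS : IsSimpleModule Λ S) : S ≤ N := by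
  have hat := isSimpleModule_iff_isAtom.1 hS
  have h := hat.le_iff.1 (inf_le_right : N ⊓ S ≤ S)
  exact inf_eq_right.1 (h.resolve_left (hN S hat.1))

/-- A simple submodule of `Iᵐ` has projective dimension at least `m`. -/
theorem not_hasProjectiveDimensionLT (m : ℕ) (S : Submodule Λ (J.I m)) [hS : IsSimpleModule Λ S] :
    ¬ HasProjectiveDimensionLT (ModuleCat.of Λ S) m := by
  intro h
  have := IsSimpleModule.nontrivial Λ S
  cases m with
  | zero =>
    have := ModuleCat.isZero_iff_subsingleton.1 (isZero_of_hasProjectiveDimensionLT_zero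
      (ModuleCat.of Λ S))
    exact not_subsingleton S this
  | succ m =>
    have hext := J.subsingleton_ext_cosyzygy (ModuleCat.of Λ S) m 0
      (HasProjectiveDimensionLT.subsingleton _ (m + 1) _ le_rfl _)
    have hle : S ≤ LinearMap.ker (J.d (m + 1)) := simple_le_of_essential (J.essential (m + 1)) hS
    -- The obstruction to lifting `S ⊆ Zᵐ⁺¹` along `Iᵐ → Zᵐ⁺¹` lies in `Ext¹(S, Zᵐ) = 0`.
    obtain ⟨x, hx⟩ := Abelian.Ext.covariant_sequence_exact₃ _ (J.shortExact m)
      (Abelian.Ext.mk₀ (ModuleCat.ofHom (Submodule.inclusion hle))) (zero_add 1)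
      (Subsingleton.elim _ _)
    obtain ⟨s, rfl⟩ := Abelian.Ext.homEquiv₀.symm.surjective x
    have hs : s ≫ ModuleCat.ofHom (J.toCosyzygy m) = ModuleCat.ofHom (Submodule.inclusion hle) :=
      Abelian.Ext.homEquiv₀.symm.injective (by simpa using hx)
    have hs' (y : S) : J.d m (s.hom y) = y :=
      congrArg Subtype.val (LinearMap.congr_fun (congrArg ModuleCat.Hom.hom hs) y)
    have hinj : Function.Injective s.hom := fun a b hab ↦ by
      rw [← Subtype.val_inj, ← hs', ← hs', hab]
    have hS' : IsSimpleModule Λ (LinearMap.range s.hom) :=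
      IsSimpleModule.congr (LinearEquiv.ofInjective s.hom hinj).symm
    have hle' := simple_le_of_essential (J.essential m) hS'
    obtain ⟨y, hy⟩ := exists_ne (0 : S)
    exact hy (Subtype.ext ((hs' y).symm.trans (hle' ⟨y, rfl⟩)))

theorem hasInjectiveDimensionLT_cosyzygy (i j : ℕ)
    (h : HasInjectiveDimensionLT (J.cosyzygy (i + j)) 0) :
    HasInjectiveDimensionLT (J.cosyzygy i) j := by
  induction j generalizing i with
  | zero => exact h
  | succ j ih =>
    have := ModuleCat.injective_of_module (J.injective_I i)
    exact (J.shortExact i).hasInjectiveDimensionLT_X₁ j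
      (ih (i + 1) (by rwa [show i + 1 + j = i + (j + 1) by lia]))
      (inferInstanceAs (HasInjectiveDimensionLT (J.I i) (j + 1)))

/-- If `Iᵐ = 0` then `M` has injective dimension less than `m`. -/
theorem hasInjectiveDimensionLT_of_subsingleton (m : ℕ) [Subsingleton (J.I m)] :
    HasInjectiveDimensionLT (ModuleCat.of Λ M) m := by
  have : HasInjectiveDimensionLT (J.cosyzygy 0) m := by
    refine J.hasInjectiveDimensionLT_cosyzygy 0 m ?_
    rw [zero_add]
    exact (ModuleCat.isZero_of_subsingleton (J.cosyzygy m)).hasInjectiveDimensionLT_zero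
  let e : M ≃ₗ[Λ] LinearMap.ker (J.d 0) :=
    (LinearEquiv.ofInjective J.ε J.injective_ε).trans
      (LinearEquiv.ofEq _ _ (LinearMap.exact_iff.1 J.exact_zero).symm)
  exact hasInjectiveDimensionLT_of_iso e.symm.toModuleIso m

/-- If `Λ` has global dimension `n` and `Iᵐ` is the `m`-th term of the minimal injective resolution
of `Λ`, with `m ≤ n`, then `Iᵐ` has a simple submodule. -/
theorem exists_simple [IsArtinianRing Λ] {n : ℕ} (hn : globalDimension Λ = n)
    (K : MinimalInjectiveResolution Λ Λ) {m : ℕ} (hm : m ≤ n) :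
    ∃ S : Submodule Λ (K.I m), IsSimpleModule Λ S := by
  have hgl (X : ModuleCat.{v} Λ) : HasProjectiveDimensionLT X (n + 1) :=
    (projectiveDimension_le_iff X n).1 (hn ▸ le_iSup _ X)
  have hnt : Nontrivial (K.I m) := by
    rw [← not_subsingleton_iff_nontrivial]
    intro hsub
    have h1 := K.hasInjectiveDimensionLT_of_subsingleton m
    have h2 : HasInjectiveDimensionLT (ModuleCat.of Λ Λ) n := hasInjectiveDimensionLT_of_ge _ m n hm
    refine hn.not_lt ?_
    cases n with
    | zero =>
      -- For `n = 0` the ring would be zero, with global dimension `⊥` rather than `0`.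
      have : Subsingleton Λ := ModuleCat.isZero_iff_subsingleton.1
        (isZero_of_hasInjectiveDimensionLT_zero (ModuleCat.of Λ Λ))
      have hbot (X : ModuleCat.{v} Λ) : projectiveDimension X ≤ ⊥ := by
        have := Module.subsingleton Λ X
        exact ((projectiveDimension_eq_bot_iff X).2 (ModuleCat.isZero_of_subsingleton X)).le
      exact (iSup_le hbot).trans_lt (WithBot.bot_lt_coe _)
    | succ n =>
      have hle : globalDimension Λ ≤ n := iSup_le fun X ↦ (projectiveDimension_le_iff X n).2
        (hasProjectiveDimensionLT_of_hasInjectiveDimensionLT_self hgl h2 X)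
      exact hle.trans_lt (by exact_mod_cast Nat.lt_succ_self n)
  obtain ⟨x, hx⟩ := exists_ne (0 : K.I m)
  have : IsArtinian Λ (Submodule.span Λ {x}) := isArtinian_span_of_finite Λ (Set.finite_singleton x)
  have hne : Nontrivial (Submodule.span Λ {x}) :=
    (Submodule.nontrivial_iff_ne_bot).2 (by simpa using hx)
  obtain ⟨T, hT⟩ := IsAtomic.exists_atom (Submodule Λ (Submodule.span Λ {x}))
  have hT' := isSimpleModule_iff_isAtom.2 hT
  exact ⟨T.map (Submodule.subtype _), IsSimpleModule.congr
    (Submodule.equivMapOfInjective _ (Submodule.injective_subtype _) T).symm⟩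

end MinimalInjectiveResolution

/-! ### The two simple modules -/

theorem proposition3p6 (R : Type u) [CommRing R] [IsArtinianRing R]
    (Λ : Type v) [Ring Λ] [Algebra R Λ] [Module.Finite R Λ]
    (hΛ : IsAuslanderRegular Λ) (n : ℕ) (hn : globalDimension Λ = n) :
    (1 ≤ n → ∃ S₁ : ModuleCat.{v} Λ, IsSimpleModule Λ S₁ ∧
      projectiveDimension S₁ = ((n - 1 : ℕ) : WithBot ℕ∞)) ∧
    (∃ S₂ : ModuleCat.{v} Λ, IsSimpleModule Λ S₂ ∧ projectiveDimension S₂ = n) := by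
  have : IsArtinianRing Λ := IsArtinianRing.of_finite R Λ
  obtain ⟨-, -, J, hJ⟩ := hΛ.1 n
  constructor
  · intro h1
    obtain ⟨m, rfl⟩ : ∃ m, n = m + 1 := ⟨n - 1, by lia⟩
    rw [Nat.add_sub_cancel]
    obtain ⟨S, hS⟩ := J.exists_simple hn (Nat.le_succ m)
    refine ⟨ModuleCat.of Λ S, hS, le_antisymm ?_
      ((projectiveDimension_ge_iff _ m).2 (J.not_hasProjectiveDimensionLT m S))⟩
    rw [projectiveDimension_le_iff]
    exact (ModuleCat.shortExact_quotient S).hasProjectiveDimensionLT_X₁ (m + 1)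
      (hJ m (Nat.lt_succ_self m)).hasProjectiveDimensionLE
      ((projectiveDimension_le_iff _ (m + 1)).1 (hn ▸ le_iSup _ _))
  · obtain ⟨S, hS⟩ := J.exists_simple hn le_rfl
    exact ⟨ModuleCat.of Λ S, hS, le_antisymm (hn ▸ le_iSup _ _)
      ((projectiveDimension_ge_iff _ n).2 (J.not_hasProjectiveDimensionLT n S))⟩
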